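/- Let $\nu$ be a northeast path, i.e. a finite (possibly empty) sequence of steps $N=(0,1)$ and $E=(1,0)$ starting at $(0,0)$, ending at $(m,n)$. Let $F_\nu$ be the part of the rectangle $[0,m]\times[0,n]$ that lies weakly above $\nu$, and let $A_\nu=F_\nu\cap\mathbb{Z}^2$. A $\nu$-path is a northeast path $\mu$ from $(0,0)$ to $(m,n)$ that stays inside $F_\nu$; $\mathcal D_\nu$ is the set of $\nu$-paths. A valley of a northeast path is a lattice point on it that is preceded by an east step and followed by a north step. For $\mu\in\mathcal D_\nu$ let $\mathrm{val}(\mu)$ be the number of valleys of $\mu$, and $\mathrm{ret}(\mu)$ the number of valleys of $\mu$ that are also valleys of $\nu$. Put $$\deg(\nu)=\max_{\mu\in\mathcal D_\nu}\mathrm{val}(\mu),\qquad H_\nu(x,y)=\sum_{\mu\in\mathcal D_\nu}x^{\mathrm{val}(\mu)}y^{\mathrm{ret}(\mu)}.$$ Two points of $A_\nu$ are $\nu$-incompatible if one is strictly southwest of the other (both coordinates strictly smaller) and the smallest axis-parallel rectangle containing both lies in $F_\nu$; otherwise they are $\nu$-compatible. The $\nu$-Tamari complex $\mathcal{TC}(\nu)$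 is the simplicial complex whose faces are the sets of pairwise $\nu$-compatible points of $A_\nu$ (including the empty set). Let $d'-1$ be its dimension, let $f_{i-1}$ be its number of faces with exactly $i$ elements (so $f_{-1}=1$), define its $h$-vector $(h'_0,h'_1,\ldots)$ by $$\sum_{i=0}^{d'}h'_i x^i=\sum_{i=0}^{d'}f_{i-1}\,x^i(1-x)^{d'-i}$$ (with $h'_i=0$ for $i>d'$), and let $\tilde h_{\mathcal{TC}(\nu)}(x)=\sum_{i=0}^{d'}h'_i x^i$. Then $h'_i>0$ for $0\le i\le\deg(\nu)$, and $h'_i=0$ for all $i>\deg(\nu)$. Moreover, $$H_\nu(x,1)=\tilde h_{\mathcal{TC}(\nu)}(x).$$ -/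

import Mathlib

namespace NuTamari

/-! ### Northeast paths -/

/-- The two kinds of unit steps in `ℕ × ℕ`. -/
inductive Step where
  | north : Step
  | east : Step
  deriving DecidableEq

/-- A northeast path, as the word of its steps; it starts at the origin. -/
abbrev NEPath : Type := List Step

/-- The lattice point reached by `μ` after its first `k` steps (for `k ≤ μ.length`). -/
def point (μ : NEPath) (k : ℕ) : ℕ × ℕ :=
  ((μ.take k).count Step.east, (μ.take k).count Step.north)

/-- The final point of `μ`. -/
def endpoint (μ : NEPath) : ℕ × ℕ := point μ μ.length

/-- The lattice points lying on `μ`. -/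
def points (μ : NEPath) : Finset (ℕ × ℕ) :=
  (Finset.range (μ.length + 1)).image (point μ)

/-- The lattice points of the Ferrers diagram of `ν`: the points of the smallest rectangle
containing `ν` that are weakly above `ν`, i.e. on `ν` or vertically above a point of `ν`. -/
def latticePoints (ν : NEPath) : Finset (ℕ × ℕ) :=
  (Finset.Icc (0, 0) (endpoint ν)).filter fun p => ∃ q ∈ points ν, q.1 = p.1 ∧ q.2 ≤ p.2

/-- The valleys of `μ`: the points of `μ` preceded by an east step and followed by a
north step. -/
def valleys (μ : NEPath) : Finset (ℕ × ℕ) :=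
  ((Finset.range μ.length).filter fun k =>
    μ[k]? = some Step.east ∧ μ[k + 1]? = some Step.north).image fun k => point μ (k + 1)

/-- The number of valleys. -/
def val (μ : NEPath) : ℕ := (valleys μ).card

/-- The number of returns of `μ` (with respect to `ν`): valleys of `μ` that are also
valleys of `ν`. -/
def ret (ν μ : NEPath) : ℕ := (valleys μ ∩ valleys ν).card

/-- `μ` is a `ν`-path: it has the same end points as `ν` and stays in the Ferrers diagram
of `ν`. -/
def IsNuPath (ν μ : NEPath) : Prop :=
  endpoint μ = endpoint ν ∧ points μ ⊆ latticePoints ν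

theorem length_eq_endpoint (μ : NEPath) : μ.length = (endpoint μ).1 + (endpoint μ).2 := by
  unfold endpoint point
  simp only [List.take_length]
  induction μ with
  | nil => rfl
  | cons a l ih => cases a <;> simp [ih] <;> omega

instance : Finite Step :=
  Finite.of_injective (fun s : Step => decide (s = Step.north)) fun a b h => by
    cases a <;> cases b <;> simp_all

theorem finite_setOf_isNuPath (ν : NEPath) : {μ : NEPath | IsNuPath ν μ}.Finite :=
  (List.finite_length_eq Step ν.length).subset fun μ hμ => by
    have h : endpoint μ = endpoint ν := hμ.1
    simp only [Set.mem_ofPred_eq, length_eq_endpoint, h]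

/-- The finite set of all `ν`-paths. -/
noncomputable def nuPaths (ν : NEPath) : Finset NEPath := (finite_setOf_isNuPath ν).toFinset

/-- The degree of `ν`: the maximal number of valleys of a `ν`-path. -/
noncomputable def deg (ν : NEPath) : ℕ := (nuPaths ν).sup val

/-- The `H`-triangle of `ν`, a polynomial in the two variables `x = X 0` and `y = X 1`. -/
noncomputable def hTriangle (ν : NEPath) : MvPolynomial (Fin 2) ℤ :=
  ∑ μ ∈ nuPaths ν, MvPolynomial.X 0 ^ val μ * MvPolynomial.X 1 ^ ret ν μ

/-! ### The Tamari complex -/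

/-- `p` is strictly southwest of `q`. -/
def StrictSW (p q : ℕ × ℕ) : Prop := p.1 < q.1 ∧ p.2 < q.2

/-- One of `p`, `q` is strictly southwest of the other and the smallest rectangle
containing both lies in the Ferrers diagram of `ν`. -/
def Incompatible (ν : NEPath) (p q : ℕ × ℕ) : Prop :=
  (StrictSW p q ∧ Finset.Icc p q ⊆ latticePoints ν) ∨
    (StrictSW q p ∧ Finset.Icc q p ⊆ latticePoints ν)

/-- The `ν`-Tamari complex: its faces are the sets of pairwise `ν`-compatible lattice points
of the Ferrers diagram of `ν`. (In Mathlib's convention the empty face is not listed.) -/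
def tamariComplex (ν : NEPath) : PreAbstractSimplicialComplex (ℕ × ℕ) where
  faces := {s | s.Nonempty ∧ s ⊆ latticePoints ν ∧ ∀ p ∈ s, ∀ q ∈ s, ¬ Incompatible ν p q}
  isRelLowerSet_faces := fun _ hs =>
    ⟨hs.1, fun _ hts ht =>
      ⟨ht, hts.trans hs.2.1, fun p hp q hq => hs.2.2 p (hts hp) q (hts hq)⟩⟩

/-! ### The `h`-vector of a finite simplicial complex -/

/-- The number `f_{i-1}` of faces of dimension `i - 1`, i.e. with `i` vertices; there is
exactly one face of dimension `-1`, the empty one. -/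
noncomputable def faceNumber {α : Type*} (K : PreAbstractSimplicialComplex α) : ℕ → ℕ
  | 0 => 1
  | i + 1 => {s : Finset α | s ∈ K ∧ s.card = i + 1}.ncard

/-- The number `d` with `dim K = d - 1`: the largest number of vertices of a face of the
finite complex `K`. -/
noncomputable def dimSucc {α : Type*} (K : PreAbstractSimplicialComplex α) : ℕ :=
  sSup {k : ℕ | ∃ s ∈ K, s.card = k}

/-- The entry `h_i` of the `h`-vector of a finite complex of dimension `d - 1`: the coefficient
of `x ^ i` in `∑_{j = 0}^{d} f_{j-1} x ^ j (1 - x) ^ (d - j)`. -/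
noncomputable def hVector {α : Type*} (K : PreAbstractSimplicialComplex α) (i : ℕ) : ℤ :=
  (∑ j ∈ Finset.range (dimSucc K + 1),
    (faceNumber K j : Polynomial ℤ) * Polynomial.X ^ j *
      (1 - Polynomial.X) ^ (dimSucc K - j)).coeff i

/-- The polynomial `∑_{i = 0}^{d} h_i x ^ i`. -/
noncomputable def hTilde {α : Type*} (K : PreAbstractSimplicialComplex α) : Polynomial ℤ :=
  ∑ i ∈ Finset.range (dimSucc K + 1), Polynomial.C (hVector K i) * Polynomial.X ^ i

end NuTamari

/-! The complex and the `ν`-paths satisfy the same recursion. Write `ν` as `E^a N ν'`. A `ν`-path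
either starts with `N` and continues as a path for `E^a ν'`, or makes `a - b ≥ 1` east steps and
then a north step, which creates one valley, and continues as a path for `E^b ν'`. Give valleys
weight `u`, and weight `w` to each of the remaining `ℓ + 1 - val` units, where `ℓ` is the length;
the total weight is then `rowRec u w` (`sum_pathWeight`).

For the complex, insert the points of the bottom row from right to left. Faces through `(k, 0)`,
with no bottom point to its left, avoid the upper points in columns `k + 1, ..., a`. The upper
points that remain are a copy of the diagram of `E^k ν'`, and the `a - k` bottom points to the right
have become cone points, each giving a factor `1 + X`. So the face polynomial satisfies the
recursion with `u = X` and `w = 1 + X` (`indepSum_latticePoints`).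

Hence it equals the sum of `X^val (1 + X)^(ℓ + 1 - val)` over `ν`-paths. The complex therefore has
`d' = ℓ + 1`, and passing from `f` to `h` turns each summand into `X^val`: `h'_i` counts the
`ν`-paths with `i` valleys. Vanishing above the degree is then immediate. Positivity below it says
that the valley numbers have no gaps, which follows from the recursion with `u = X` and `w = 1`. -/

namespace NuTamari

open Polynomial

/-! ### Rows of a path -/

/-- The largest first coordinate of a point of `ν` at height at most `j`. -/
def rowEnd : NEPath → ℕ → ℕ
  | [], _ => 0
  | Step.east :: ν, j => rowEnd ν j + 1
  | Step.north :: _, 0 => 0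
  | Step.north :: ν, j + 1 => rowEnd ν j

theorem rowEnd_replicate_append (a : ℕ) (ν : NEPath) (j : ℕ) :
    rowEnd (List.replicate a Step.east ++ ν) j = a + rowEnd ν j := by
  induction a with
  | zero => simp
  | succ a ih => simp only [List.replicate_succ, List.cons_append, rowEnd, ih]; omega

theorem rowEnd_mono (ν : NEPath) : Monotone (rowEnd ν) := by
  induction ν with
  | nil => intro i j _; simp [rowEnd]
  | cons s ν ih =>
    intro i j hij
    cases s with
    | east => simpa [rowEnd] using ih hij
    | north =>
      cases i with
      | zero => simp [rowEnd]
      | succ i =>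
        obtain ⟨j, rfl⟩ : ∃ k, j = k + 1 := ⟨j - 1, by omega⟩
        exact ih (by omega)

theorem rowEnd_le_count (ν : NEPath) (j : ℕ) : rowEnd ν j ≤ ν.count Step.east := by
  induction ν generalizing j with
  | nil => simp [rowEnd]
  | cons s ν ih =>
    cases s with
    | east => simpa [rowEnd] using ih j
    | north => cases j <;> simp [rowEnd, ih]

theorem endpoint_eq (ν : NEPath) : endpoint ν = (ν.count Step.east, ν.count Step.north) := by
  simp [endpoint, point]

theorem points_nil : points [] = {(0, 0)} := by
  simp [points, point]

theorem mem_points_cons (s : Step) (ν : NEPath) (p : ℕ × ℕ) :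
    p ∈ points (s :: ν) ↔
      p = (0, 0) ∨ ∃ q ∈ points ν, p = (q.1 + [s].count Step.east, q.2 + [s].count Step.north) := by
  simp only [points, Finset.mem_image, Finset.mem_range, List.length_cons]
  constructor
  · rintro ⟨k, hk, rfl⟩
    cases k with
    | zero => left; simp [point]
    | succ k =>
      right
      refine ⟨_, ⟨k, by omega, rfl⟩, ?_⟩
      simp [point, List.count_cons]
  · rintro (rfl | ⟨q, ⟨k, hk, rfl⟩, rfl⟩)
    · exact ⟨0, by omega, by simp [point]⟩
    · exact ⟨k + 1, by omega, by simp [point, List.count_cons]⟩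

/-- The path starts in column `0` and never skips a column, so up to height `j` it meets exactly the
columns up to its row end. The diagram is thus determined by its row ends and its height. -/
theorem exists_mem_points_iff (ν : NEPath) (i j : ℕ) :
    (∃ q ∈ points ν, q.1 = i ∧ q.2 ≤ j) ↔ i ≤ rowEnd ν j := by
  induction ν generalizing i j with
  | nil => simp [points_nil, rowEnd, eq_comm]
  | cons s ν ih =>
    cases s with
    | east =>
      simp only [mem_points_cons, rowEnd]
      constructor
      · rintro ⟨q, rfl | ⟨q, hq, rfl⟩, rfl, h⟩
        · simp
        · have := (ih q.1 j).1 ⟨q, hq, rfl, by simpa using h⟩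
          simpa using this
      · intro h
        cases i with
        | zero => exact ⟨(0, 0), Or.inl rfl, rfl, by simp⟩
        | succ i =>
          obtain ⟨q, hq, h1, h2⟩ := (ih i j).2 (by omega)
          exact ⟨_, Or.inr ⟨q, hq, rfl⟩, by simpa using h1, by simpa using h2⟩
    | north =>
      simp only [mem_points_cons]
      constructor
      · rintro ⟨q, rfl | ⟨q, hq, rfl⟩, rfl, h⟩
        · simp
        · cases j with
          | zero => simp at h
          | succ j =>
            have := (ih q.1 j).1 ⟨q, hq, rfl, by simpa using h⟩
            simpa [rowEnd] using this
      · intro h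
        cases j with
        | zero =>
          simp only [rowEnd, Nat.le_zero] at h
          exact ⟨(0, 0), Or.inl rfl, h.symm, by simp⟩
        | succ j =>
          obtain ⟨q, hq, h1, h2⟩ := (ih i j).2 h
          exact ⟨_, Or.inr ⟨q, hq, rfl⟩, by simpa using h1, by simpa using h2⟩

theorem mem_latticePoints_iff (ν : NEPath) (p : ℕ × ℕ) :
    p ∈ latticePoints ν ↔ p.2 ≤ ν.count Step.north ∧ p.1 ≤ rowEnd ν p.2 := by
  simp only [latticePoints, Finset.mem_filter, exists_mem_points_iff, Finset.mem_Icc, endpoint_eq,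
    Prod.le_def]
  have := rowEnd_le_count ν p.2
  constructor
  · rintro ⟨⟨_, h⟩, h'⟩; exact ⟨h.2, h'⟩
  · rintro ⟨h, h'⟩; exact ⟨⟨by simp, by omega, h⟩, h'⟩

theorem rowEnd_mem_points (μ : NEPath) (j : ℕ) (hj : j ≤ μ.count Step.north) :
    (rowEnd μ j, j) ∈ points μ := by
  induction μ generalizing j with
  | nil => simpa [points_nil, rowEnd] using hj
  | cons s μ ih =>
    rw [mem_points_cons]
    cases s with
    | east => exact Or.inr ⟨_, ih j (by simpa using hj), by simp [rowEnd]⟩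
    | north =>
      cases j with
      | zero => left; simp [rowEnd]
      | succ j => exact Or.inr ⟨_, ih j (by simpa using hj), by simp [rowEnd]⟩

theorem snd_le_of_mem_points {μ : NEPath} {p : ℕ × ℕ} (hp : p ∈ points μ) :
    p.2 ≤ μ.count Step.north := by
  obtain ⟨k, -, rfl⟩ := Finset.mem_image.1 hp
  exact (List.take_sublist k μ).count_le _

theorem rowEnd_eq_of_count_le (ν : NEPath) (j : ℕ) (hj : ν.count Step.north ≤ j) :
    rowEnd ν j = ν.count Step.east := by
  induction ν generalizing j with
  | nil => simp [rowEnd]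
  | cons s ν ih =>
    cases s with
    | east => simpa [rowEnd] using ih j (by simpa using hj)
    | north =>
      cases j with
      | zero => simp at hj
      | succ j => simpa [rowEnd] using ih j (by simpa using hj)

/-- Only the rightmost point of the path in each row can violate the diagram condition. Above the
top row both row ends equal the total number of east steps, so `j` need not be bounded. -/
theorem isNuPath_iff (ν μ : NEPath) :
    IsNuPath ν μ ↔ μ.count Step.east = ν.count Step.east ∧
      μ.count Step.north = ν.count Step.north ∧ ∀ j, rowEnd μ j ≤ rowEnd ν j := by
  simp only [IsNuPath, endpoint_eq, Prod.mk.injEq, and_assoc]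
  refine and_congr_right fun hE => and_congr_right fun hN => ?_
  constructor
  · intro h j
    by_cases hj : j ≤ μ.count Step.north
    · exact ((mem_latticePoints_iff ν _).1 (h (rowEnd_mem_points μ j hj))).2
    · rw [rowEnd_eq_of_count_le μ j (by omega), rowEnd_eq_of_count_le ν j (by omega), hE]
  · intro h p hp
    rw [mem_latticePoints_iff]
    refine ⟨hN ▸ snd_le_of_mem_points hp, le_trans ?_ (h _)⟩
    exact (exists_mem_points_iff μ p.1 p.2).1 ⟨p, hp, rfl, le_rfl⟩

theorem mem_nuPaths (ν μ : NEPath) : μ ∈ nuPaths ν ↔ IsNuPath ν μ := by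
  simp [nuPaths]

/-! ### Counting valleys -/

theorem point_fst_add_snd (μ : NEPath) (k : ℕ) (hk : k ≤ μ.length) :
    (point μ k).1 + (point μ k).2 = k := by
  have := length_eq_endpoint (μ.take k)
  simp only [endpoint_eq, List.length_take] at this
  simp only [point]
  omega

/-- A point of the path determines its index, which is the sum of its coordinates, so counting
valleys as points or as positions in the word agrees. The latter is suited to recursion on the first
step. -/
theorem val_eq_sum (μ : NEPath) :
    val μ = ∑ k ∈ Finset.range μ.length,
      if μ[k]? = some Step.east ∧ μ[k + 1]? = some Step.north then 1 else 0 := by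
  rw [val, valleys, Finset.card_image_of_injOn, Finset.card_filter]
  intro k hk l hl h
  simp only [Finset.coe_filter, Finset.mem_range, Set.mem_ofPred_eq] at hk hl h
  have h1 := point_fst_add_snd μ (k + 1) (by omega)
  have h2 := point_fst_add_snd μ (l + 1) (by omega)
  rw [h] at h1
  omega

theorem val_nil : val [] = 0 := by simp [val_eq_sum]

theorem val_cons_north (μ : NEPath) : val (Step.north :: μ) = val μ := by
  rw [val_eq_sum, val_eq_sum, List.length_cons, Finset.sum_range_succ']
  simp

theorem val_cons_east (μ : NEPath) :
    val (Step.east :: μ) = val μ + if μ.head? = some Step.north then 1 else 0 := by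
  rw [val_eq_sum, val_eq_sum, List.length_cons, Finset.sum_range_succ']
  simp [List.head?_eq_getElem?]

theorem val_le_length (μ : NEPath) : val μ ≤ μ.length := by
  rw [val_eq_sum]
  calc _ ≤ ∑ k ∈ Finset.range μ.length, 1 :=
        Finset.sum_le_sum fun k _ => by split_ifs <;> simp
    _ = _ := by simp

/-! ### Weighted sums over paths -/

section PathSum

variable {R : Type*} [CommSemiring R]

/-- The recursion satisfied by the weighted numbers of paths above `a` east steps followed
by `ν`, where valleys have weight `u` and the other steps have weight `w`. -/
def rowRec (u w : R) : NEPath → ℕ → R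
  | [], a => w ^ (a + 1)
  | Step.east :: ν, a => rowRec u w ν (a + 1)
  -- The first summand collects the paths starting north. In the second, `a - b` is the length of
  -- the initial run of east steps; together with the north step after it, the run has `a - b + 1`
  -- steps, one of which is charged `u` for the valley.
  | Step.north :: ν, a =>
    w * rowRec u w ν a + ∑ b ∈ Finset.range a, u * w ^ (a - b) * rowRec u w ν b

/-- The weight of a path. -/
def pathWeight (u w : R) (μ : NEPath) : R := u ^ val μ * w ^ (μ.length + 1 - val μ)

theorem pathWeight_cons_north (u w : R) (μ : NEPath) :
    pathWeight u w (Step.north :: μ) = w * pathWeight u w μ := by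
  have h := val_le_length μ
  rw [pathWeight, pathWeight, val_cons_north, List.length_cons,
    show μ.length + 1 + 1 - val μ = μ.length + 1 - val μ + 1 by omega, pow_succ]
  ring

theorem pathWeight_east_north (u w : R) (μ : NEPath) :
    pathWeight u w (Step.east :: Step.north :: μ) = u * w * pathWeight u w μ := by
  have h := val_le_length μ
  simp only [pathWeight, val_cons_east, val_cons_north, List.length_cons, List.head?_cons, if_true]
  rw [show μ.length + 1 + 1 + 1 - (val μ + 1) = μ.length + 1 - val μ + 1 by omega]
  ring

theorem pathWeight_east_east (u w : R) (μ : NEPath) :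
    pathWeight u w (Step.east :: Step.east :: μ) = w * pathWeight u w (Step.east :: μ) := by
  have h := val_le_length (Step.east :: μ)
  have h' : val (Step.east :: Step.east :: μ) = val (Step.east :: μ) := by
    rw [val_cons_east (Step.east :: μ)]; simp
  rw [pathWeight, pathWeight, h']
  simp only [List.length_cons] at h ⊢
  rw [show μ.length + 1 + 1 + 1 - val (Step.east :: μ) =
    μ.length + 1 + 1 - val (Step.east :: μ) + 1 by omega]
  ring

/-! ### Decomposition of `ν`-paths by their first steps. -/

theorem mem_nuPaths_replicate (a : ℕ) (μ : NEPath) :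
    μ ∈ nuPaths (List.replicate a Step.east) ↔ μ = List.replicate a Step.east := by
  rw [mem_nuPaths, isNuPath_iff]
  constructor
  · rintro ⟨h1, h2, -⟩
    rw [List.eq_replicate_iff]
    simp only [List.count_replicate_self] at h1
    have h3 : μ.count Step.north = 0 := by
      rw [h2, List.count_replicate]; simp
    refine ⟨?_, ?_⟩
    · rw [length_eq_endpoint, endpoint_eq, h1, h3]; rfl
    · rintro (_ | _) hb
      · exact absurd hb (List.count_eq_zero.1 h3)
      · rfl
  · rintro rfl
    exact ⟨rfl, rfl, fun _ => le_rfl⟩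

theorem nuPaths_zero_north (ν : NEPath) :
    nuPaths (Step.north :: ν) = (nuPaths ν).image (Step.north :: ·) := by
  ext μ
  simp only [Finset.mem_image, mem_nuPaths, isNuPath_iff]
  constructor
  · rintro ⟨h1, h2, h3⟩
    match μ with
    | [] => simp at h2
    | Step.east :: μ => have := h3 0; simp [rowEnd] at this
    | Step.north :: μ =>
      exact ⟨μ, ⟨by simpa using h1, by simpa using h2, fun j => by simpa [rowEnd] using h3 (j + 1)⟩,
        rfl⟩
  · rintro ⟨μ, ⟨h1, h2, h3⟩, rfl⟩
    refine ⟨by simpa using h1, by simpa using h2, fun j => ?_⟩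
    cases j with
    | zero => simp [rowEnd]
    | succ j => simpa [rowEnd] using h3 j

/-- Removing an initial north step lowers all rows by one, which deletes the `N` of the bounding
word; removing an initial east step shifts all row ends by one, which deletes an `E`. -/
theorem nuPaths_succ_north (a : ℕ) (ν : NEPath) :
    nuPaths (List.replicate (a + 1) Step.east ++ Step.north :: ν) =
      (nuPaths (List.replicate (a + 1) Step.east ++ ν)).image (Step.north :: ·) ∪
      (nuPaths (List.replicate a Step.east ++ Step.north :: ν)).image (Step.east :: ·) := by
  ext μ
  simp only [Finset.mem_union, Finset.mem_image, mem_nuPaths, isNuPath_iff,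
    rowEnd_replicate_append, List.count_append, List.count_replicate]
  constructor
  · rintro ⟨h1, h2, h3⟩
    match μ with
    | [] => simp at h2
    | Step.east :: μ =>
      refine Or.inr ⟨μ, ⟨?_, by simpa using h2, fun j => ?_⟩, rfl⟩
      · simp at h1 ⊢; omega
      · have := h3 j
        simp only [rowEnd] at this; omega
    | Step.north :: μ =>
      refine Or.inl ⟨μ, ⟨by simpa using h1, by simpa using h2, fun j => ?_⟩, rfl⟩
      simpa [rowEnd] using h3 (j + 1)
  · rintro (⟨μ, ⟨h1, h2, h3⟩, rfl⟩ | ⟨μ, ⟨h1, h2, h3⟩, rfl⟩)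
    · refine ⟨by simpa using h1, by simpa using h2, fun j => ?_⟩
      cases j with
      | zero => simp [rowEnd]
      | succ j => simpa [rowEnd] using h3 j
    · refine ⟨?_, by simpa using h2, fun j => ?_⟩
      · simp at h1 ⊢; omega
      · have := h3 j
        simp only [rowEnd]; omega

theorem sum_nuPaths_succ_north {M : Type*} [AddCommMonoid M] (f : NEPath → M) (a : ℕ)
    (ν : NEPath) :
    ∑ μ ∈ nuPaths (List.replicate (a + 1) Step.east ++ Step.north :: ν), f μ =
      ∑ μ ∈ nuPaths (List.replicate (a + 1) Step.east ++ ν), f (Step.north :: μ) +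
      ∑ μ ∈ nuPaths (List.replicate a Step.east ++ Step.north :: ν), f (Step.east :: μ) := by
  rw [nuPaths_succ_north, Finset.sum_union, Finset.sum_image, Finset.sum_image]
  · intro μ _ μ' _ h; simpa using h
  · intro μ _ μ' _ h; simpa using h
  · rw [Finset.disjoint_left]
    simp only [Finset.mem_image]
    rintro _ ⟨μ, -, rfl⟩ ⟨μ', -, h⟩
    simp at h

/-- Sorts the paths with a forced first east step by the length `a + 1 - b` of their initial east
run. In the induction, a second step north ends the run with `b = a`, and a second step east
contributes a factor `w`. -/
theorem sum_pathWeight_east_north (u w : R) (ν : NEPath) (a : ℕ) :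
    ∑ μ ∈ nuPaths (List.replicate a Step.east ++ Step.north :: ν),
        pathWeight u w (Step.east :: μ) =
      ∑ b ∈ Finset.range (a + 1), u * w ^ (a + 1 - b) *
        ∑ μ ∈ nuPaths (List.replicate b Step.east ++ ν), pathWeight u w μ := by
  induction a with
  | zero =>
    simp only [List.replicate_zero, List.nil_append, nuPaths_zero_north]
    rw [Finset.sum_image (by intro μ _ μ' _ h; simpa using h)]
    simp [pathWeight_east_north, Finset.mul_sum]
  | succ a ih =>
    rw [sum_nuPaths_succ_north, Finset.sum_range_succ, add_comm]
    simp only [pathWeight_east_north, pathWeight_east_east, ← Finset.mul_sum]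
    rw [ih, Finset.mul_sum]
    congr 1
    · refine Finset.sum_congr rfl fun b hb => ?_
      have := Finset.mem_range.1 hb
      rw [show a + 1 + 1 - b = a + 1 - b + 1 by omega]
      ring
    · simp

theorem sum_pathWeight (u w : R) (ν : NEPath) (a : ℕ) :
    ∑ μ ∈ nuPaths (List.replicate a Step.east ++ ν), pathWeight u w μ = rowRec u w ν a := by
  induction ν generalizing a with
  | nil =>
    have h : nuPaths (List.replicate a Step.east) = {List.replicate a Step.east} := by
      ext μ; simp [mem_nuPaths_replicate]
    have hv : ∀ a, val (List.replicate a Step.east) = 0 := by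
      intro a
      induction a with
      | zero => exact val_nil
      | succ a ih =>
        rw [List.replicate_succ, val_cons_east, ih]
        cases a <;> simp [List.replicate_succ]
    simp [h, pathWeight, hv, rowRec]
  | cons s ν ih =>
    cases s with
    | east =>
      rw [rowRec, ← ih, List.replicate_succ', List.append_assoc, List.singleton_append]
    | north =>
      cases a with
      | zero =>
        simp only [List.replicate_zero, List.nil_append, nuPaths_zero_north]
        rw [Finset.sum_image (by intro μ _ μ' _ h; simpa using h)]
        simp only [pathWeight_cons_north, ← Finset.mul_sum, rowRec, ← ih]
        simp
      | succ a =>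
        rw [sum_nuPaths_succ_north, sum_pathWeight_east_north, rowRec]
        simp only [pathWeight_cons_north, ← Finset.mul_sum, ih]

end PathSum

/-! ### Generating functions of independent sets -/

open Classical in
/-- The independent subsets of `V` with respect to the relation `R`. -/
noncomputable def indepSets {α : Type*} (R : α → α → Prop) (V : Finset α) : Finset (Finset α) :=
  V.powerset.filter fun S => ∀ p ∈ S, ∀ q ∈ S, ¬ R p q

/-- The generating function of the independent subsets of `V` by cardinality. -/
noncomputable def indepSum {α : Type*} (R : α → α → Prop) (V : Finset α) : ℤ[X] :=
  ∑ S ∈ indepSets R V, X ^ S.card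

theorem mem_indepSets {α : Type*} {R : α → α → Prop} {V S : Finset α} :
    S ∈ indepSets R V ↔ S ⊆ V ∧ ∀ p ∈ S, ∀ q ∈ S, ¬ R p q := by
  simp [indepSets]

-- Independent sets are split according to whether they contain `v`.
open Classical in
theorem indepSum_insert {α : Type*} [DecidableEq α] {R : α → α → Prop}
    (hR : ∀ p q, R p q → R q p) {V : Finset α} {v : α}
    (hv : v ∉ V) (hvv : ¬ R v v) :
    indepSum R (insert v V) = indepSum R V + X * indepSum R (V.filter fun q => ¬ R v q) := by
  have h : indepSets R (insert v V) =
      indepSets R V ∪ (indepSets R (V.filter fun q => ¬ R v q)).image (insert v) := by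
    ext S
    simp only [Finset.mem_union, Finset.mem_image, mem_indepSets]
    constructor
    · rintro ⟨h1, h2⟩
      by_cases hS : v ∈ S
      · refine Or.inr ⟨S.erase v, ⟨fun q hq => ?_, fun p hp q hq => ?_⟩, Finset.insert_erase hS⟩
        · obtain ⟨hq1, hq2⟩ := Finset.mem_erase.1 hq
          exact Finset.mem_filter.2
            ⟨(Finset.mem_insert.1 (h1 hq2)).resolve_left hq1, h2 v hS q hq2⟩
        · exact h2 p (Finset.mem_of_mem_erase hp) q (Finset.mem_of_mem_erase hq)
      · exact Or.inl ⟨(Finset.subset_insert_iff_of_notMem hS).1 h1, h2⟩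
    · rintro (⟨h1, h2⟩ | ⟨S, ⟨h1, h2⟩, rfl⟩)
      · exact ⟨h1.trans (Finset.subset_insert _ _), h2⟩
      · refine ⟨Finset.insert_subset_insert _ (h1.trans (Finset.filter_subset _ _)), ?_⟩
        have h3 : ∀ q ∈ S, ¬ R v q := fun q hq => (Finset.mem_filter.1 (h1 hq)).2
        intro p hp q hq
        rcases Finset.mem_insert.1 hp with hpv | hp <;>
          rcases Finset.mem_insert.1 hq with hqv | hq
        · exact hpv ▸ hqv ▸ hvv
        · exact hpv ▸ h3 q hq
        · exact fun h => h3 p hp (hR _ _ (hqv ▸ h))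
        · exact h2 p hp q hq
  have hmem : ∀ S ∈ indepSets R (V.filter fun q => ¬ R v q), v ∉ S := fun S hS hvS =>
    hv (Finset.mem_filter.1 ((mem_indepSets.1 hS).1 hvS)).1
  rw [indepSum, h, Finset.sum_union, Finset.sum_image, indepSum, indepSum, Finset.mul_sum]
  · congr 1
    refine Finset.sum_congr rfl fun S hS => ?_
    rw [Finset.card_insert_of_notMem (hmem S hS), pow_succ']
  · intro S hS T hT hST
    rw [← Finset.erase_insert (hmem S hS), ← Finset.erase_insert (hmem T hT)]
    exact congrArg (Finset.erase · v) hST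
  · rw [Finset.disjoint_left]
    intro S hS hS'
    obtain ⟨T, -, rfl⟩ := Finset.mem_image.1 hS'
    exact hv ((mem_indepSets.1 hS).1 (Finset.mem_insert_self _ _))

/-- A point related to no other point may be added or omitted freely, hence one factor `1 + X` for
each. -/
theorem indepSum_union_cone {α : Type*} [DecidableEq α] {R : α → α → Prop}
    (hR : ∀ p q, R p q → R q p) {C V : Finset α}
    (hd : Disjoint C V) (hC : ∀ c ∈ C, ∀ q ∈ C ∪ V, ¬ R c q) :
    indepSum R (C ∪ V) = (1 + X) ^ C.card * indepSum R V := by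
  induction C using Finset.induction_on with
  | empty => simp
  | insert c C hc ih =>
    classical
    rw [Finset.disjoint_insert_left] at hd
    have hcone : ∀ q ∈ C ∪ V, ¬ R c q := fun q hq =>
      hC c (Finset.mem_insert_self _ _) q (by rw [Finset.insert_union]; exact Finset.mem_insert_of_mem hq)
    rw [Finset.insert_union, indepSum_insert hR (by simp [hc, hd.1])
        (hC c (Finset.mem_insert_self _ _) c (by simp)),
      Finset.filter_true_of_mem hcone, ih hd.2, Finset.card_insert_of_notMem hc]
    · ring
    · intro d hdC q hq
      exact hC d (Finset.mem_insert_of_mem hdC) q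
        (by rw [Finset.insert_union]; exact Finset.mem_insert_of_mem hq)

theorem indepSum_image {α β : Type*} [DecidableEq β] {R : α → α → Prop} {R' : β → β → Prop} {V : Finset α} {f : α → β}
    (hf : Function.Injective f) (h : ∀ p ∈ V, ∀ q ∈ V, (R' (f p) (f q) ↔ R p q)) :
    indepSum R' (V.image f) = indepSum R V := by
  classical
  have him : indepSets R' (V.image f) = (indepSets R V).image (Finset.image f) := by
    ext S
    simp only [Finset.mem_image, mem_indepSets]
    constructor
    · rintro ⟨h1, h2⟩
      obtain ⟨T, hT, rfl⟩ := Finset.subset_image_iff.1 h1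
      refine ⟨T, ⟨hT, fun p hp q hq hpq => ?_⟩, rfl⟩
      exact h2 _ (Finset.mem_image_of_mem f hp) _ (Finset.mem_image_of_mem f hq)
        ((h p (hT hp) q (hT hq)).2 hpq)
    · rintro ⟨T, ⟨hT, h2⟩, rfl⟩
      refine ⟨Finset.image_subset_image hT, ?_⟩
      simp only [Finset.mem_image]
      rintro _ ⟨p, hp, rfl⟩ _ ⟨q, hq, rfl⟩ hpq
      exact h2 p hp q hq ((h p (hT hp) q (hT hq)).1 hpq)
  rw [indepSum, him, Finset.sum_image fun S _ T _ hST => Finset.image_injective hf hST, indepSum]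
  exact Finset.sum_congr rfl fun S _ => by rw [Finset.card_image_of_injective _ hf]

theorem coeff_indepSum {α : Type*} (R : α → α → Prop) (V : Finset α) (k : ℕ) :
    (indepSum R V).coeff k = ((indepSets R V).filter fun S => S.card = k).card := by
  simp [indepSum, finsetSum_coeff, coeff_X_pow, eq_comm]

/-! ### The face generating function of the Tamari complex -/

/-- Incompatibility of two lattice points in terms of the row ends. -/
def Cross (ν : NEPath) (p q : ℕ × ℕ) : Prop :=
  (p.1 < q.1 ∧ p.2 < q.2 ∧ q.1 ≤ rowEnd ν p.2) ∨ (q.1 < p.1 ∧ q.2 < p.2 ∧ p.1 ≤ rowEnd ν q.2)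

theorem cross_symm (ν : NEPath) : ∀ p q, Cross ν p q → Cross ν q p := fun _ _ h => h.symm

/-- Row ends grow with height, so the rectangle lies in the diagram as soon as its southeast corner
`(q.1, p.2)` does. -/
theorem Icc_subset_latticePoints_iff {ν : NEPath} {p q : ℕ × ℕ} (hpq : StrictSW p q)
    (hq : q ∈ latticePoints ν) :
    Finset.Icc p q ⊆ latticePoints ν ↔ q.1 ≤ rowEnd ν p.2 := by
  obtain ⟨h1, h2⟩ := hpq
  rw [mem_latticePoints_iff] at hq
  constructor
  · intro h
    have hc : (q.1, p.2) ∈ Finset.Icc p q := by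
      simp only [Finset.mem_Icc, Prod.le_def]; omega
    exact ((mem_latticePoints_iff ν _).1 (h hc)).2
  · intro h r hr
    simp only [Finset.mem_Icc, Prod.le_def] at hr
    have := rowEnd_mono ν hr.1.2
    rw [mem_latticePoints_iff]
    omega

theorem incompatible_iff_cross {ν : NEPath} {p q : ℕ × ℕ} (hp : p ∈ latticePoints ν)
    (hq : q ∈ latticePoints ν) : Incompatible ν p q ↔ Cross ν p q := by
  unfold Incompatible Cross
  refine or_congr ?_ ?_
  · rw [← and_assoc]
    exact and_congr_right fun h => Icc_subset_latticePoints_iff h hq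
  · rw [← and_assoc]
    exact and_congr_right fun h => Icc_subset_latticePoints_iff h hp

/-- The lattice points `(x, 0)` with `k ≤ x ≤ a`. -/
def bottomRow (k a : ℕ) : Finset (ℕ × ℕ) := (Finset.Ico k (a + 1)).image fun x => (x, 0)

theorem mem_bottomRow {k a : ℕ} {p : ℕ × ℕ} : p ∈ bottomRow k a ↔ k ≤ p.1 ∧ p.1 ≤ a ∧ p.2 = 0 := by
  obtain ⟨x, y⟩ := p
  simp only [bottomRow, Finset.mem_image, Finset.mem_Ico, Prod.mk.injEq]
  constructor
  · rintro ⟨z, h, rfl, rfl⟩; omega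
  · rintro ⟨h1, h2, h3⟩; exact ⟨x, by omega, rfl, h3.symm⟩

theorem card_bottomRow (k a : ℕ) : (bottomRow k a).card = a + 1 - k := by
  rw [bottomRow, Finset.card_image_of_injective _ (fun x y h => by simpa using h), Nat.card_Ico]

/-- Move all points one row up, and those to the right of column `k` by `c` columns. -/
def spread (k c : ℕ) (p : ℕ × ℕ) : ℕ × ℕ := (if p.1 ≤ k then p.1 else p.1 + c, p.2 + 1)

theorem spread_injective (k c : ℕ) : Function.Injective (spread k c) := by
  rintro ⟨x, y⟩ ⟨x', y'⟩ h
  simp only [spread, Prod.mk.injEq] at h ⊢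
  split_ifs at h <;> omega

/-- Deleting columns `k + 1, ..., a` above the bottom row leaves a copy of the diagram of `E^k ν`,
since every upper row end is at least `a`. -/
theorem mem_spread_latticePoints {k a : ℕ} (hk : k ≤ a) (ν : NEPath) (p : ℕ × ℕ) :
    p ∈ (latticePoints (List.replicate k Step.east ++ ν)).image (spread k (a - k)) ↔
      p ∈ latticePoints (List.replicate a Step.east ++ Step.north :: ν) ∧ p.2 ≠ 0 ∧
        (p.1 ≤ k ∨ a < p.1) := by
  simp only [Finset.mem_image, mem_latticePoints_iff, rowEnd_replicate_append, List.count_append,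
    List.count_replicate]
  obtain ⟨x, y⟩ := p
  constructor
  · rintro ⟨⟨x', y'⟩, ⟨h1, h2⟩, h⟩
    simp only [spread, Prod.mk.injEq] at h h1 h2
    obtain ⟨h, rfl⟩ := h
    simp only [rowEnd, List.count_cons_self, beq_iff_eq] at h1 ⊢
    split_ifs at h <;> simp at h1 ⊢ <;> omega
  · rintro ⟨⟨h1, h2⟩, h3, h4⟩
    obtain ⟨y, rfl⟩ : ∃ z, y = z + 1 := ⟨y - 1, by simp at h3; omega⟩
    simp only [rowEnd] at h2
    refine ⟨(if x ≤ k then x else x - (a - k), y), ⟨?_, ?_⟩, ?_⟩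
    · simpa using h1
    · dsimp only at h4 ⊢
      split_ifs <;> omega
    · dsimp only [spread] at h4 ⊢
      simp only [Prod.mk.injEq, and_true]
      split_ifs <;> omega

/-- Spreading preserves the strict order of both coordinates. It also carries the row-end condition
along, because row ends `k + r` become `a + r`. -/
theorem indepSum_spread {k a : ℕ} (hk : k ≤ a) (ν : NEPath) :
    indepSum (Cross (List.replicate a Step.east ++ Step.north :: ν))
        ((latticePoints (List.replicate k Step.east ++ ν)).image (spread k (a - k))) =
      indepSum (Cross (List.replicate k Step.east ++ ν))
        (latticePoints (List.replicate k Step.east ++ ν)) := by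
  refine indepSum_image (spread_injective _ _) fun p _ q _ => ?_
  obtain ⟨x, y⟩ := p
  obtain ⟨x', y'⟩ := q
  simp only [Cross, spread, rowEnd_replicate_append, rowEnd]
  split_ifs <;> omega

/-- Bottom points are added from right to left. The summand for `b` counts the faces whose leftmost
bottom point is `(b, 0)`; the first term counts those with no bottom point. -/
theorem indepSum_cross_rows (a : ℕ) (ν : NEPath) (k : ℕ) (hk : k ≤ a + 1) :
    indepSum (Cross (List.replicate a Step.east ++ Step.north :: ν))
        (bottomRow k a ∪ (latticePoints (List.replicate a Step.east ++ ν)).image (spread a (a - a)))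
      = indepSum (Cross (List.replicate a Step.east ++ ν))
          (latticePoints (List.replicate a Step.east ++ ν)) +
        ∑ b ∈ Finset.Ico k (a + 1), X * (1 + X) ^ (a - b) *
          indepSum (Cross (List.replicate b Step.east ++ ν))
            (latticePoints (List.replicate b Step.east ++ ν)) := by
  classical
  induction hk using Nat.decreasingInduction with
  | self =>
    have h : bottomRow (a + 1) a = ∅ := by simp [bottomRow]
    rw [h, Finset.empty_union, indepSum_spread le_rfl]
    simp
  | of_succ k hk ih =>
    have hk' : k ≤ a := by omega
    set U := (latticePoints (List.replicate a Step.east ++ ν)).image (spread a (a - a)) with hU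
    have hins : bottomRow k a ∪ U = insert (k, 0) (bottomRow (k + 1) a ∪ U) := by
      rw [← Finset.insert_union]
      congr 1
      ext ⟨x, y⟩
      simp only [mem_bottomRow, Finset.mem_insert, Prod.mk.injEq]
      omega
    have hrow0 : rowEnd (List.replicate a Step.east ++ Step.north :: ν) 0 = a := by
      simp [rowEnd_replicate_append, rowEnd]
    -- The bottom row ends at `a`, so an upper point crosses `(k, 0)` exactly when its column lies
    -- in `k + 1, ..., a`. Once these are gone, the bottom points to the right of `(k, 0)` cross
    -- nothing.
    have hfil : (bottomRow (k + 1) a ∪ U).filter (fun q =>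
        ¬ Cross (List.replicate a Step.east ++ Step.north :: ν) (k, 0) q) =
        bottomRow (k + 1) a ∪
          (latticePoints (List.replicate k Step.east ++ ν)).image (spread k (a - k)) := by
      ext ⟨x, y⟩
      simp only [Finset.mem_filter, Finset.mem_union, hU, mem_spread_latticePoints le_rfl,
        mem_spread_latticePoints hk', mem_bottomRow, Cross, hrow0]
      constructor
      · rintro ⟨h | h, h'⟩
        · exact Or.inl h
        · exact Or.inr ⟨h.1, by omega⟩
      · rintro (h | h)
        · exact ⟨Or.inl h, by omega⟩
        · exact ⟨Or.inr ⟨h.1, by omega⟩, by omega⟩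
    rw [hins, indepSum_insert (cross_symm _), ih, hfil, indepSum_union_cone (cross_symm _),
      indepSum_spread hk', card_bottomRow, Finset.sum_eq_sum_Ico_succ_bot (by omega : k < a + 1),
      show a + 1 - (k + 1) = a - k by omega]
    · ring
    · rw [Finset.disjoint_left]
      intro p hp hp'
      rw [mem_spread_latticePoints hk'] at hp'
      exact hp'.2.1 (mem_bottomRow.1 hp).2.2
    · rintro ⟨x, y⟩ hc ⟨x', y'⟩ hq
      simp only [Finset.mem_union, mem_spread_latticePoints hk', mem_bottomRow] at hc hq
      obtain ⟨h1, h2, rfl⟩ := hc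
      simp only [Cross, hrow0]
      omega
    · simp only [Finset.mem_union, hU, mem_spread_latticePoints le_rfl, mem_bottomRow]
      omega
    · simp [Cross]

theorem indepSum_latticePoints (ν : NEPath) (a : ℕ) :
    indepSum (Cross (List.replicate a Step.east ++ ν))
      (latticePoints (List.replicate a Step.east ++ ν)) = rowRec X (1 + X) ν a := by
  induction ν generalizing a with
  | nil =>
    have h : latticePoints (List.replicate a Step.east ++ []) = bottomRow 0 a ∪ ∅ := by
      ext ⟨x, y⟩
      rw [mem_latticePoints_iff, rowEnd_replicate_append, Finset.union_empty, mem_bottomRow]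
      simp [rowEnd, List.count_replicate]
      omega
    rw [h, indepSum_union_cone (cross_symm _) (by simp), card_bottomRow, rowRec]
    · have h' : indepSets (Cross (List.replicate a Step.east ++ [])) ∅ = {∅} := by
        ext S
        simp only [mem_indepSets, Finset.subset_empty, Finset.mem_singleton]
        exact ⟨And.left, by rintro rfl; simp⟩
      rw [indepSum, h', Finset.sum_singleton, Finset.card_empty, pow_zero, mul_one, Nat.sub_zero]
    · rintro ⟨x, y⟩ hp ⟨x', y'⟩ hq
      simp only [Finset.union_empty, mem_bottomRow] at hp hq
      simp only [Cross]
      omega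
  | cons s ν ih =>
    cases s with
    | east =>
      rw [rowRec, ← ih, List.replicate_succ', List.append_assoc, List.singleton_append]
    | north =>
      have h : latticePoints (List.replicate a Step.east ++ Step.north :: ν) =
          bottomRow 0 a ∪
            (latticePoints (List.replicate a Step.east ++ ν)).image (spread a (a - a)) := by
        ext ⟨x, y⟩
        simp only [Finset.mem_union, mem_spread_latticePoints le_rfl, mem_bottomRow]
        by_cases hy : y = 0
        · subst hy
          simp [mem_latticePoints_iff, rowEnd_replicate_append, rowEnd]
        · simp [hy]; omega
      -- The summand `b = a` is `X` times the polynomial standing outside the sum; together they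
      -- give the coefficient `w = 1 + X`.
      rw [h, indepSum_cross_rows a ν 0 (by omega), rowRec, Nat.Ico_zero_eq_range,
        Finset.sum_range_succ]
      simp only [ih]
      simp only [Nat.sub_self, pow_zero]
      ring

/-! ### The `h`-polynomial -/

theorem length_of_mem_nuPaths {ν μ : NEPath} (h : μ ∈ nuPaths ν) : μ.length = ν.length := by
  rw [length_eq_endpoint, length_eq_endpoint, ((mem_nuPaths ν μ).1 h).1]

theorem self_mem_nuPaths (ν : NEPath) : ν ∈ nuPaths ν :=
  (mem_nuPaths ν ν).2 ((isNuPath_iff ν ν).2 ⟨rfl, rfl, fun _ => le_rfl⟩)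

theorem indepSum_cross_eq (ν : NEPath) :
    indepSum (Cross ν) (latticePoints ν) =
      ∑ μ ∈ nuPaths ν, X ^ val μ * (1 + X) ^ (ν.length + 1 - val μ) := by
  have h := indepSum_latticePoints ν 0
  rw [← sum_pathWeight] at h
  simp only [List.replicate_zero, List.nil_append] at h
  rw [h]
  exact Finset.sum_congr rfl fun μ hμ => by rw [pathWeight, length_of_mem_nuPaths hμ]

theorem mem_tamariComplex_iff (ν : NEPath) (S : Finset (ℕ × ℕ)) :
    S ∈ tamariComplex ν ↔ S.Nonempty ∧ S ∈ indepSets (Cross ν) (latticePoints ν) := by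
  change (S.Nonempty ∧ S ⊆ latticePoints ν ∧ ∀ p ∈ S, ∀ q ∈ S, ¬ Incompatible ν p q) ↔ _
  rw [mem_indepSets]
  refine and_congr_right fun _ => and_congr_right fun hS => ?_
  exact forall₂_congr fun p hp => forall₂_congr fun q hq =>
    not_congr (incompatible_iff_cross (hS hp) (hS hq))

theorem faceNumber_tamariComplex (ν : NEPath) (k : ℕ) :
    (faceNumber (tamariComplex ν) k : ℤ) =
      (indepSum (Cross ν) (latticePoints ν)).coeff k := by
  rw [coeff_indepSum]
  cases k with
  | zero =>
    have h : (indepSets (Cross ν) (latticePoints ν)).filter (fun S => S.card = 0) = {∅} := by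
      ext S
      simp only [Finset.mem_filter, mem_indepSets, Finset.card_eq_zero, Finset.mem_singleton]
      constructor
      · exact fun h => h.2
      · rintro rfl; simp
    rw [h, Finset.card_singleton]; rfl
  | succ k =>
    rw [faceNumber, ← Set.ncard_coe_finset]
    congr 2
    ext S
    simp only [Set.mem_ofPred_eq, Finset.coe_filter, mem_tamariComplex_iff]
    constructor
    · rintro ⟨⟨-, h⟩, h'⟩; exact ⟨h, h'⟩
    · rintro ⟨h, h'⟩; exact ⟨⟨Finset.card_pos.1 (by omega), h⟩, h'⟩

theorem coeff_X_pow_mul_one_add_X_pow (v e k : ℕ) :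
    (X ^ v * (1 + X) ^ e : ℤ[X]).coeff k = if v ≤ k then (e.choose (k - v) : ℤ) else 0 := by
  rw [coeff_X_pow_mul']
  simp [coeff_one_add_X_pow]

/-- Each summand `X^v (1 + X)^(ℓ + 1 - v)` is monic of degree `ℓ + 1`, and positive leading
coefficients cannot cancel. -/
theorem dimSucc_tamariComplex (ν : NEPath) : dimSucc (tamariComplex ν) = ν.length + 1 := by
  have hcoeff : ∀ k, (indepSum (Cross ν) (latticePoints ν)).coeff k =
      ∑ μ ∈ nuPaths ν,
        if val μ ≤ k then ((ν.length + 1 - val μ).choose (k - val μ) : ℤ) else 0 := fun k => by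
    simp only [indepSum_cross_eq, finsetSum_coeff, coeff_X_pow_mul_one_add_X_pow]
  have hval : ∀ μ ∈ nuPaths ν, val μ ≤ ν.length := fun μ hμ =>
    length_of_mem_nuPaths hμ ▸ val_le_length μ
  refine IsGreatest.csSup_eq ⟨?_, ?_⟩
  · have hpos : 0 < (indepSum (Cross ν) (latticePoints ν)).coeff (ν.length + 1) := by
      rw [hcoeff]
      refine Finset.sum_pos (fun μ hμ => ?_) ⟨ν, self_mem_nuPaths ν⟩
      have := hval μ hμ
      rw [if_pos (by omega), Nat.choose_self]
      exact one_pos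
    rw [coeff_indepSum, Nat.cast_pos, Finset.card_pos] at hpos
    obtain ⟨S, hS⟩ := hpos
    rw [Finset.mem_filter] at hS
    exact ⟨S, (mem_tamariComplex_iff ν S).2 ⟨Finset.card_pos.1 (by omega), hS.1⟩, hS.2⟩
  · rintro k ⟨S, hS, rfl⟩
    by_contra! hlt
    have h0 : (indepSum (Cross ν) (latticePoints ν)).coeff S.card = 0 := by
      rw [hcoeff]
      refine Finset.sum_eq_zero fun μ hμ => ?_
      have := hval μ hμ
      rw [if_pos (by omega), Nat.choose_eq_zero_of_lt (by omega), Nat.cast_zero]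
    rw [coeff_indepSum, Nat.cast_eq_zero, Finset.card_eq_zero] at h0
    have : S ∈ (indepSets (Cross ν) (latticePoints ν)).filter (fun T => T.card = S.card) :=
      Finset.mem_filter.2 ⟨((mem_tamariComplex_iff ν S).1 hS).2, rfl⟩
    simp [h0] at this

/-- The substitution turning the `f`-polynomial into the `h`-polynomial. -/
theorem sum_coeff_mul_X_pow_mul_one_sub_X_pow {v d : ℕ} (hv : v ≤ d) :
    ∑ j ∈ Finset.range (d + 1),
      C ((X ^ v * (1 + X) ^ (d - v) : ℤ[X]).coeff j) * X ^ j * (1 - X) ^ (d - j) =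
        (X ^ v : ℤ[X]) := by
  obtain ⟨e, rfl⟩ := Nat.exists_eq_add_of_le hv
  simp only [coeff_X_pow_mul_one_add_X_pow, Nat.add_sub_cancel_left]
  rw [add_assoc, Finset.sum_range_add, Finset.sum_eq_zero, zero_add]
  · have h := add_pow (X : ℤ[X]) (1 - X) e
    rw [add_sub_cancel, one_pow] at h
    refine Eq.trans ?_ ((congrArg (X ^ v * ·) h.symm).trans (mul_one _))
    simp only [Finset.mul_sum]
    refine Finset.sum_congr rfl fun i hi => ?_
    rw [if_pos (by omega), Nat.add_sub_cancel_left, Nat.add_sub_add_left, pow_add]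
    rw [map_natCast]
    ring
  · intro j hj
    rw [if_neg (by simpa using hj)]
    simp

theorem hPolynomial_tamariComplex (ν : NEPath) :
    ∑ j ∈ Finset.range (dimSucc (tamariComplex ν) + 1),
      (faceNumber (tamariComplex ν) j : ℤ[X]) * X ^ j *
        (1 - X) ^ (dimSucc (tamariComplex ν) - j) = ∑ μ ∈ nuPaths ν, X ^ val μ := by
  rw [dimSucc_tamariComplex]
  have h : ∀ j, (faceNumber (tamariComplex ν) j : ℤ[X]) =
      ∑ μ ∈ nuPaths ν, C ((X ^ val μ * (1 + X) ^ (ν.length + 1 - val μ) : ℤ[X]).coeff j) :=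
    fun j => by
      rw [← map_sum, ← finsetSum_coeff, ← indepSum_cross_eq, ← faceNumber_tamariComplex]
      simp
  simp only [h, Finset.sum_mul]
  rw [Finset.sum_comm]
  refine Finset.sum_congr rfl fun μ hμ => sum_coeff_mul_X_pow_mul_one_sub_X_pow ?_
  have := val_le_length μ
  rw [length_of_mem_nuPaths hμ] at this
  omega

theorem hVector_tamariComplex (ν : NEPath) (i : ℕ) :
    hVector (tamariComplex ν) i = ((nuPaths ν).filter fun μ => val μ = i).card := by
  rw [hVector, hPolynomial_tamariComplex]
  simp [finsetSum_coeff, coeff_X_pow, eq_comm]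

theorem hTilde_tamariComplex (ν : NEPath) :
    hTilde (tamariComplex ν) = ∑ μ ∈ nuPaths ν, X ^ val μ := by
  have hdeg : (∑ μ ∈ nuPaths ν, (X : ℤ[X]) ^ val μ).natDegree <
      dimSucc (tamariComplex ν) + 1 := by
    rw [dimSucc_tamariComplex, Nat.lt_succ_iff]
    refine natDegree_sum_le_of_forall_le _ _ fun μ hμ => ?_
    have := val_le_length μ
    rw [length_of_mem_nuPaths hμ] at this
    rw [natDegree_X_pow]
    omega
  rw [as_sum_range' _ _ hdeg, hTilde]
  refine Finset.sum_congr rfl fun i _ => ?_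
  rw [hVector, hPolynomial_tamariComplex, C_mul_X_pow_eq_monomial]

/-! ### The numbers of valleys of `ν`-paths form an interval -/

/-- With coefficients in `ℕ`, a larger `a` only adds nonnegative terms to the recursion. -/
theorem coeff_rowRec_mono (ν : NEPath) (i : ℕ) :
    Monotone fun a => (rowRec (X : ℕ[X]) 1 ν a).coeff i := by
  induction ν generalizing i with
  | nil => intro a b _; simp [rowRec]
  | cons s ν ih =>
    intro a b hab
    cases s with
    | east => exact ih i (by omega : a + 1 ≤ b + 1)
    | north =>
      simp only [rowRec, one_mul, one_pow, mul_one, coeff_add, finsetSum_coeff]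
      refine add_le_add (ih i hab) ?_
      exact Finset.sum_le_sum_of_subset (Finset.range_mono hab)

/-- If paths with `i + 1` valleys start north, induction applies to the rest. Otherwise some
continuation over `E^b ν` with `b < a` has `i` valleys, and by monotonicity so does a path over `E^a
ν`, to which an initial north step adds no valley. -/
theorem coeff_rowRec_pos_of_succ (ν : NEPath) (a i : ℕ)
    (h : 0 < (rowRec (X : ℕ[X]) 1 ν a).coeff (i + 1)) :
    0 < (rowRec (X : ℕ[X]) 1 ν a).coeff i := by
  induction ν generalizing a i with
  | nil => simp [rowRec, coeff_one] at h
  | cons s ν ih =>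
    cases s with
    | east => exact ih (a + 1) i h
    | north =>
      simp only [rowRec, one_mul, one_pow, mul_one, coeff_add, finsetSum_coeff,
        coeff_X_mul] at h ⊢
      refine Nat.add_pos_left ?_ _
      rcases Nat.eq_zero_or_pos ((rowRec (X : ℕ[X]) 1 ν a).coeff (i + 1)) with h0 | h0
      · rw [h0, zero_add] at h
        obtain ⟨b, hb, hpos⟩ := Finset.exists_ne_zero_of_sum_ne_zero h.ne'
        exact (Nat.pos_of_ne_zero hpos).trans_le
          (coeff_rowRec_mono ν i (Finset.mem_range.1 hb).le)
      · exact ih a i h0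

theorem coeff_rowRec (ν : NEPath) (i : ℕ) :
    (rowRec (X : ℕ[X]) 1 ν 0).coeff i = ((nuPaths ν).filter fun μ => val μ = i).card := by
  rw [← sum_pathWeight]
  simp [pathWeight, finsetSum_coeff, coeff_X_pow, eq_comm]

theorem card_filter_val_pos (ν : NEPath) {i : ℕ} (hi : i ≤ deg ν) :
    0 < ((nuPaths ν).filter fun μ => val μ = i).card := by
  rw [← coeff_rowRec]
  -- Descends from the maximum, which some `ν`-path attains.
  induction hi using Nat.decreasingInduction with
  | self =>
    rw [coeff_rowRec, Finset.card_pos]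
    obtain ⟨μ, hμ, h⟩ := Finset.exists_mem_eq_sup (nuPaths ν) ⟨ν, self_mem_nuPaths ν⟩ val
    exact ⟨μ, Finset.mem_filter.2 ⟨hμ, h.symm⟩⟩
  | of_succ i _ ih => exact coeff_rowRec_pos_of_succ ν 0 i ih

end NuTamari

theorem proposition5 (ν : NuTamari.NEPath) :
    (∀ i : ℕ, i ≤ NuTamari.deg ν →
      0 < NuTamari.hVector (NuTamari.tamariComplex ν) i) ∧
    (∀ i : ℕ, NuTamari.deg ν < i →
      NuTamari.hVector (NuTamari.tamariComplex ν) i = 0) ∧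
    MvPolynomial.aeval ![(Polynomial.X : Polynomial ℤ), 1] (NuTamari.hTriangle ν) =
      NuTamari.hTilde (NuTamari.tamariComplex ν) := by
  refine ⟨fun i hi => ?_, fun i hi => ?_, ?_⟩
  · rw [NuTamari.hVector_tamariComplex]
    exact_mod_cast NuTamari.card_filter_val_pos ν hi
  · rw [NuTamari.hVector_tamariComplex, Nat.cast_eq_zero, Finset.card_eq_zero,
      Finset.filter_eq_empty_iff]
    intro μ hμ h
    have : NuTamari.val μ ≤ NuTamari.deg ν := Finset.le_sup hμ
    omega
  · rw [NuTamari.hTilde_tamariComplex, NuTamari.hTriangle]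
    simp
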